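/- For a positive integer $n$ let $\mathcal F_4(n)$ be the family of all sets $\{0,\,i,\,i+1,\,j,\,j+1\}$ with integers $1\le i$, $i+2\le j$, $j\le n-1$, partially ordered by $\{a_1<\dots<a_5\}\preceq\{b_1<\dots<b_5\}$ if and only if $a_k\le b_k$ for all $k=1,\dots,5$. Let $I\subseteq\mathcal F_4(n)$ be a nonempty order ideal, i.e. $g\in I$ whenever $g\in\mathcal F_4(n)$ and $g\preceq f$ for some $f\in I$. Let the squeezed $4$-ball $B(I)$ be the abstract simplicial complex whose facets are the members of $I$, and let the squeezed $3$-sphere $S(I)$ be its boundary complex, i.e. the complex spanned by the $4$-element sets that are contained in exactly one member of $I$. Then $S(I)$ can be realized as the boundary complex of a simplicial convex $4$-polytope: there is a $4$-dimensional convex polytope $P\subset\mathbb R^4$ all of whose proper faces are simplices, and a bijection from the vertices of $S(I)$ to the vertices of $P$ under which the faces of $S(I)$ correspond exactly to the vertex sets of the nonempty proper faces of $P$. -/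

import Mathlib

namespace KalaiSqueezed

/-- The family `F_3(n)`: all 4-element subsets of `{1, …, n}` of the form
`{i, i+1} ∪ {j, j+1}` with `1 ≤ i`, `i + 2 ≤ j`, `j < n`. -/
def F3 (n : ℕ) : Set (Finset ℕ) :=
  {s | ∃ i j : ℕ, 1 ≤ i ∧ i + 2 ≤ j ∧ j < n ∧ s = {i, i + 1} ∪ {j, j + 1}}

/-- The family `F_4(n) = 0 * F_3(n)`: all sets `{0} ∪ f'` with `f' ∈ F_3(n)`. -/
def F4 (n : ℕ) : Set (Finset ℕ) :=
  {f | ∃ f' ∈ F3 n, f = {0} ∪ f'}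

/-- The componentwise partial order on the `r`-element subsets of `ℕ`: with the elements listed in
increasing order, `s = {a_1 < … < a_r} ⪯ t = {b_1 < … < b_r}` iff `a_k ≤ b_k` for every `k`. -/
def ComponentwiseLE (r : ℕ) (s t : Finset ℕ) : Prop :=
  ∃ a b : Fin r → ℕ, StrictMono a ∧ StrictMono b ∧
    s = Finset.univ.image a ∧ t = Finset.univ.image b ∧ ∀ k, a k ≤ b k

/-- `I` is an order ideal (initial set) of the poset `F_4(n)`. -/
def IsOrderIdealF4 (n : ℕ) (I : Set (Finset ℕ)) : Prop :=
  I ⊆ F4 n ∧ ∀ f ∈ I, ∀ g ∈ F4 n, ComponentwiseLE 5 g f → g ∈ I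

/-- The abstract simplicial complex spanned by a family `A` of finite sets: its faces are the
nonempty subsets of members of `A`. -/
def spannedComplex (A : Set (Finset ℕ)) : PreAbstractSimplicialComplex ℕ where
  faces := {s | s.Nonempty ∧ ∃ f ∈ A, s ⊆ f}
  isRelLowerSet_faces := by
    rintro s ⟨hs, f, hf, hsf⟩
    exact ⟨hs, fun t hts ht => ⟨ht, f, hf, hts.trans hsf⟩⟩

/-- The boundary complex of a pure `d`-dimensional simplicial complex `K` (a ball): the complex
spanned by the `(d-1)`-dimensional faces (those with `d` vertices) that lie in exactly one
`d`-dimensional face (those with `d + 1` vertices). -/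
def boundaryComplex (d : ℕ) (K : PreAbstractSimplicialComplex ℕ) :
    PreAbstractSimplicialComplex ℕ :=
  spannedComplex
    {r | r ∈ K.faces ∧ r.card = d ∧ ∃! f : Finset ℕ, f ∈ K.faces ∧ f.card = d + 1 ∧ r ⊆ f}

/-- The squeezed 4-ball `B(I)`. -/
def squeezedBall (I : Set (Finset ℕ)) : PreAbstractSimplicialComplex ℕ :=
  spannedComplex I

/-- The squeezed 3-sphere `S(I)`, the boundary complex of `B(I)`. -/
def squeezedSphere (I : Set (Finset ℕ)) : PreAbstractSimplicialComplex ℕ :=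
  boundaryComplex 4 (squeezedBall I)

section Polytopes

variable {d : ℕ}

/-- `P` is a convex `d`-polytope in `ℝ^d`: the convex hull of a finite set, of full dimension. -/
def IsConvexPolytope (P : Set (EuclideanSpace ℝ (Fin d))) : Prop :=
  (∃ s : Finset (EuclideanSpace ℝ (Fin d)), P = convexHull ℝ (s : Set (EuclideanSpace ℝ (Fin d)))) ∧
    affineSpan ℝ P = ⊤

/-- `F` is a nonempty proper face of `P`, that is, `F ≠ P` is the nonempty set of maximizers
over `P` of some linear functional. -/
def IsProperFace (P F : Set (EuclideanSpace ℝ (Fin d))) : Prop :=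
  IsExposed ℝ P F ∧ F.Nonempty ∧ F ≠ P

/-- `P` is a simplicial convex `d`-polytope: each of its proper faces is a simplex, i.e. has
affinely independent vertices. -/
def IsSimplicialPolytope (P : Set (EuclideanSpace ℝ (Fin d))) : Prop :=
  IsConvexPolytope P ∧
    ∀ F, IsProperFace P F →
      AffineIndependent ℝ ((↑) : F.extremePoints ℝ → EuclideanSpace ℝ (Fin d))

/-- The boundary complex of a simplicial polytope `P`, given by the vertex sets of the nonempty
proper faces of `P`. -/
def polytopeBoundary (P : Set (EuclideanSpace ℝ (Fin d))) :
    Set (Finset (EuclideanSpace ℝ (Fin d))) :=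
  {τ | ∃ F, IsProperFace P F ∧ (τ : Set (EuclideanSpace ℝ (Fin d))) = F.extremePoints ℝ}

/-- The simplicial complex `K` is realized as the boundary complex of `P`: some map that is
injective on the vertices of `K` carries the faces of `K` exactly to the faces of the boundary
complex of `P`. -/
def IsRealizedAsBoundary (K : PreAbstractSimplicialComplex ℕ)
    (P : Set (EuclideanSpace ℝ (Fin d))) : Prop :=
  ∃ φ : ℕ → EuclideanSpace ℝ (Fin d),
    Set.InjOn φ {v : ℕ | {v} ∈ K.faces} ∧
      ∀ τ : Finset (EuclideanSpace ℝ (Fin d)), τ ∈ polytopeBoundary P ↔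
        ∃ σ ∈ K.faces, (τ : Set (EuclideanSpace ℝ (Fin d))) = φ '' (σ : Set ℕ)

end Polytopes

end KalaiSqueezed

/-! Put the vertices `1, …, N + 1` on the moment curve at increasing parameters `t k`, and the
vertex `0` at a distant point `(0, 0, M, 0)`. An affine functional restricted to the curve is a
polynomial of degree at most 4. The one with roots `t i, t (i + 1), t j, t (j + 1)` is nonnegative
at all vertices of the curve (Gale evenness), and its value at vertex `0` is the product of the
roots minus `M` times their sum. For large `M`, vertex `0` is therefore on the inner side of this
hyperplane when the root sum is negative, and beyond it when the sum is positive. Since an order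
ideal is a staircase in `(i, j)`, a rapidly growing sequence `t` can make the sum negative exactly
on the blocks of `I` (`exists_seq_sign_pattern`).

The facets of `S(I)` avoiding `0` are then supported by the block functionals themselves. A facet
through `0` is a block of `I` with one nonzero vertex removed. It is supported by the positive
combination, vanishing at `0`, of the functional of that block with one that is negative at `0`
(`exists_combined_form`, `exists_facet_form`).

That there are no further facets needs no topology. A family of supported simplices in which every
vertex can be exchanged already gives the whole boundary (`IsFacetSystem`), and exchangeability
follows by parity, because a ridge lies in at most two blocks (`exists_boundaryFacets_exchange`). -/

namespace KalaiSqueezed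

/-! ### Maximizers of linear functionals on hulls of finite configurations. -/

section ConvexHull

variable {E : Type*} [AddCommGroup E] [Module ℝ E]

lemma exists_weights_of_mem_convexHull_image {V : Finset ℕ} {φ : ℕ → E} {x : E}
    (hx : x ∈ convexHull ℝ (φ '' (V : Set ℕ))) :
    ∃ w : ℕ → ℝ, (∀ v ∈ V, 0 ≤ w v) ∧ ∑ v ∈ V, w v = 1 ∧ ∑ v ∈ V, w v • φ v = x := by
  classical
  refine convexHull_min (t := {x | ∃ w : ℕ → ℝ, (∀ v ∈ V, 0 ≤ w v) ∧ ∑ v ∈ V, w v = 1 ∧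
    ∑ v ∈ V, w v • φ v = x}) ?_ ?_ hx
  · rintro _ ⟨v, hv, rfl⟩
    have hv' : v ∈ V := hv
    refine ⟨fun u => if u = v then 1 else 0, fun u _ => ?_, ?_, ?_⟩
    · dsimp only; split_ifs <;> norm_num
    · simp [hv']
    · simp [hv']
  · rintro _ ⟨w, hw, hw1, rfl⟩ _ ⟨w', hw', hw1', rfl⟩ a b ha hb hab
    refine ⟨fun u => a * w u + b * w' u, fun u hu => ?_, ?_, ?_⟩
    · have := hw u hu
      have := hw' u hu
      positivity
    · rw [Finset.sum_add_distrib, ← Finset.mul_sum, ← Finset.mul_sum, hw1, hw1']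
      linarith
    · simp only [add_smul, mul_smul, Finset.sum_add_distrib, Finset.smul_sum]

/-- At a maximizer the weighted slacks `w v * (m - l (φ v))` are nonnegative with sum zero, so no
weight sits outside `Z`. -/
lemma maximizers_convexHull_image {V Z : Finset ℕ} {φ : ℕ → E} (hZV : Z ⊆ V) (hZ : Z.Nonempty)
    {l : E →ₗ[ℝ] ℝ} {m : ℝ} (hl : ∀ v ∈ V, l (φ v) ≤ m) (hlZ : ∀ v ∈ V, l (φ v) = m ↔ v ∈ Z) :
    {x ∈ convexHull ℝ (φ '' (V : Set ℕ)) | ∀ y ∈ convexHull ℝ (φ '' (V : Set ℕ)), l y ≤ l x} =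
      convexHull ℝ (φ '' (Z : Set ℕ)) := by
  have hle : ∀ y ∈ convexHull ℝ (φ '' (V : Set ℕ)), l y ≤ m := by
    refine convexHull_min (t := {y | l y ≤ m}) ?_ (convex_halfSpace_le l.isLinear m)
    rintro _ ⟨v, hv, rfl⟩
    exact hl v hv
  have hsub := convexHull_mono (𝕜 := ℝ) (Set.image_mono (f := φ) (Finset.coe_subset.2 hZV))
  have heq : ∀ y ∈ convexHull ℝ (φ '' (Z : Set ℕ)), l y = m := by
    refine convexHull_min (t := {y | l y = m}) ?_ (convex_hyperplane l.isLinear m)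
    rintro _ ⟨v, hv, rfl⟩
    exact (hlZ v (hZV hv)).2 hv
  ext x
  constructor
  · rintro ⟨hx, hmax⟩
    obtain ⟨z, hz⟩ := hZ
    have hlx : l x = m := by
      refine le_antisymm (hle x hx) ?_
      rw [← (hlZ z (hZV hz)).2 hz]
      exact hmax _ (subset_convexHull ℝ _ ⟨z, hZV hz, rfl⟩)
    obtain ⟨w, hw, hw1, rfl⟩ := exists_weights_of_mem_convexHull_image hx
    have hsum : ∑ v ∈ V, w v * (m - l (φ v)) = 0 := by
      simp only [mul_sub, Finset.sum_sub_distrib, ← Finset.sum_mul, hw1]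
      simp only [map_sum, map_smul, smul_eq_mul] at hlx
      linarith
    have hzero := (Finset.sum_eq_zero_iff_of_nonneg fun v hv =>
      mul_nonneg (hw v hv) (sub_nonneg.2 (hl v hv))).1 hsum
    have hw0 : ∀ v ∈ V, v ∉ Z → w v = 0 := fun v hv hvZ => by
      rcases mul_eq_zero.1 (hzero v hv) with h | h
      · exact h
      · exact absurd ((hlZ v hv).1 (by linarith)) hvZ
    rw [← Finset.sum_subset hZV fun v hv hvZ => by rw [hw0 v hv hvZ, zero_smul]]
    refine (convex_convexHull ℝ _).sum_mem (fun v hv => hw v (hZV hv)) ?_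
      fun v hv => subset_convexHull ℝ _ ⟨v, hv, rfl⟩
    rw [← hw1, Finset.sum_subset hZV hw0]
  · intro hx
    exact ⟨hsub hx, fun y hy => (heq x hx).symm ▸ hle y hy⟩

end ConvexHull

/-! ### A criterion for a family of simplices to be the boundary of a polytope. -/

variable {d : ℕ}

/-- A system of supporting functionals of a configuration `φ` of points with labels in `V`, one for
each member `s` of the family `A` of `d`-sets, that is closed under exchanging one vertex. The
affine functional `x ↦ H s (x, 1)` is nonnegative on the configuration and vanishes exactly on the
points with labels in `s`. -/
structure IsFacetSystem (V : Finset ℕ) (φ : ℕ → EuclideanSpace ℝ (Fin d)) (A : Set (Finset ℕ))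
    (H : Finset ℕ → EuclideanSpace ℝ (Fin d) × ℝ →ₗ[ℝ] ℝ) : Prop where
  dim_pos : 0 < d
  nonempty : A.Nonempty
  subset : ∀ s ∈ A, s ⊆ V
  card : ∀ s ∈ A, s.card = d
  zero : ∀ s ∈ A, ∀ v ∈ s, H s (φ v, 1) = 0
  pos : ∀ s ∈ A, ∀ v ∈ V, v ∉ s → 0 < H s (φ v, 1)
  pivot : ∀ s ∈ A, ∀ v ∈ s, ∃ s' ∈ A, s.erase v ⊆ s' ∧ v ∉ s'

namespace IsFacetSystem

variable {V : Finset ℕ} {φ : ℕ → EuclideanSpace ℝ (Fin d)} {A : Set (Finset ℕ)}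
  {H : Finset ℕ → EuclideanSpace ℝ (Fin d) × ℝ →ₗ[ℝ] ℝ} (S : IsFacetSystem V φ A H)

include S

lemma nonneg {s : Finset ℕ} (hs : s ∈ A) {v : ℕ} (hv : v ∈ V) : 0 ≤ H s (φ v, 1) := by
  by_cases h : v ∈ s
  · exact (S.zero s hs v h).ge
  · exact (S.pos s hs v hv h).le

lemma exists_notMem {s : Finset ℕ} (hs : s ∈ A) : ∃ w ∈ V, w ∉ s := by
  obtain ⟨v, hv⟩ : s.Nonempty := Finset.card_pos.1 (S.card s hs ▸ S.dim_pos)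
  obtain ⟨s', hs', -, hvs'⟩ := S.pivot s hs v hv
  by_contra! h
  have hsub : s' ⊆ s := fun w hw => h w (S.subset s' hs' hw)
  exact hvs' (Finset.eq_of_subset_of_card_le hsub (by rw [S.card s hs, S.card s' hs']) ▸ hv)

lemma sum_pos {s : Finset ℕ} (hs : s ∈ A) : 0 < H s (∑ v ∈ V, (φ v, 1)) := by
  obtain ⟨w, hwV, hws⟩ := S.exists_notMem hs
  rw [map_sum]
  exact Finset.sum_pos' (fun v hv => S.nonneg hs hv) ⟨w, hwV, S.pos s hs w hwV hws⟩

/-- The functional of the simplex obtained by exchanging `v` vanishes on the rest of `s` but not at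
`v`, so it isolates the coefficient of `v`. -/
lemma coeff_eq_zero {s : Finset ℕ} (hs : s ∈ A) {w : ℕ → ℝ}
    (h : ∑ v ∈ s, w v • ((φ v, 1) : EuclideanSpace ℝ (Fin d) × ℝ) = 0) : ∀ v ∈ s, w v = 0 := by
  intro v hv
  obtain ⟨s', hs', hsub, hvs'⟩ := S.pivot s hs v hv
  have h' := congrArg (H s') h
  rw [map_sum, Finset.sum_eq_single v, map_smul, map_zero, smul_eq_mul] at h'
  · exact (mul_eq_zero.1 h').resolve_right (S.pos s' hs' v (S.subset s hs hv) hvs').ne'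
  · intro u hu huv
    rw [map_smul, S.zero s' hs' u (hsub (Finset.mem_erase.2 ⟨huv, hu⟩)), smul_zero]
  · exact fun h => absurd hv h

/-- The `d` points of `s` and the sum of all points form a basis of the homogenized space: `H s`
kills the former and is positive on the latter. -/
lemma exists_combination {s : Finset ℕ} (hs : s ∈ A) (z : EuclideanSpace ℝ (Fin d) × ℝ) :
    ∃ (a : ℝ) (w : ℕ → ℝ), z = a • ∑ v ∈ V, (φ v, 1) + ∑ v ∈ s, w v • (φ v, 1) := by
  classical
  set b : Option s → EuclideanSpace ℝ (Fin d) × ℝ := fun o =>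
    o.elim (∑ v ∈ V, (φ v, 1)) fun v => (φ v, 1) with hb
  have hli : LinearIndependent ℝ b := by
    rw [Fintype.linearIndependent_iff]
    intro g hg
    rw [Fintype.sum_option] at hg
    have hnone : g none = 0 := by
      have h := congrArg (H s) hg
      rw [map_add, map_smul, map_sum, Finset.sum_eq_zero, add_zero, map_zero, smul_eq_mul] at h
      · exact (mul_eq_zero.1 h).resolve_right (S.sum_pos hs).ne'
      · intro v _
        rw [map_smul]
        exact (congrArg _ (S.zero s hs v v.2)).trans (smul_zero _)
    rw [hnone, zero_smul, zero_add] at hg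
    have h0 := S.coeff_eq_zero hs (w := fun v => if h : v ∈ s then g (some ⟨v, h⟩) else 0) (by
      rw [← hg, ← Finset.sum_coe_sort s]
      exact Finset.sum_congr rfl fun v _ => by simp [hb])
    rintro (_ | ⟨v, hv⟩)
    · exact hnone
    · simpa [hv] using h0 v hv
  have hspan := hli.span_eq_top_of_card_eq_finrank' (by
    simp [S.card s hs])
  obtain ⟨c, hc⟩ := (Submodule.mem_span_range_iff_exists_fun ℝ).1
    (hspan ▸ Submodule.mem_top : z ∈ Submodule.span ℝ (Set.range b))
  refine ⟨c none, fun v => if h : v ∈ s then c (some ⟨v, h⟩) else 0, ?_⟩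
  rw [← hc, Fintype.sum_option, ← Finset.sum_coe_sort s]
  congr 1
  exact Finset.sum_congr rfl fun v _ => by simp [hb]

/-- Every vector lies, up to a multiple of the sum of all points, in the cone over some member of
the system: one minimizing the normalized value of the functionals. -/
lemma exists_nonneg_combination (z : EuclideanSpace ℝ (Fin d) × ℝ) :
    ∃ s ∈ A, ∃ (a : ℝ) (w : ℕ → ℝ), (∀ v ∈ s, 0 ≤ w v) ∧
      z = a • ∑ v ∈ V, (φ v, 1) + ∑ v ∈ s, w v • (φ v, 1) := by
  classical
  have hfin : A.Finite := V.powerset.finite_toSet.subset fun s hs =>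
    Finset.mem_coe.2 (Finset.mem_powerset.2 (S.subset s hs))
  obtain ⟨s, hs, hmin⟩ := Set.exists_min_image A
    (fun s => H s z / H s (∑ v ∈ V, (φ v, 1))) hfin S.nonempty
  obtain ⟨a, w, hz⟩ := S.exists_combination hs z
  refine ⟨s, hs, a, w, fun v hv => ?_, hz⟩
  have hmin' := fun s hs => S.sum_pos (s := s) hs
  generalize ∑ v ∈ V, ((φ v, 1) : EuclideanSpace ℝ (Fin d) × ℝ) = c at hz hmin hmin'
  -- A negative `w v` would give the simplex across `v` a smaller normalized value, against
  -- minimality.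
  obtain ⟨s', hs', hsub, hvs'⟩ := S.pivot s hs v hv
  have h1 : H s z = a * H s c := by
    rw [hz, map_add, map_smul, map_sum, Finset.sum_eq_zero, add_zero, smul_eq_mul]
    intro u hu
    rw [map_smul, S.zero s hs u hu, smul_zero]
  have h2 : H s' z = a * H s' c + w v * H s' (φ v, 1) := by
    rw [hz, map_add, map_smul, smul_eq_mul, map_sum, Finset.sum_eq_single v, map_smul,
      smul_eq_mul]
    · intro u hu huv
      rw [map_smul, S.zero s' hs' u (hsub (Finset.mem_erase.2 ⟨huv, hu⟩)), smul_zero]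
    · exact fun h => absurd hv h
  have h3 := hmin s' hs'
  rw [h1, h2, mul_div_assoc, div_self (hmin' s hs).ne', mul_one, le_div_iff₀ (hmin' s' hs')] at h3
  have h4 : 0 ≤ w v * H s' (φ v, 1) := by linarith
  exact nonneg_of_mul_nonneg_left h4 (S.pos s' hs' v (S.subset s hs hv) hvs')

/-- To `H s` add, for each `u ∈ s \ t`, the functional of the simplex exchanging `u`: it vanishes on
`t` and is positive at `u`. -/
lemma exists_face_functional {s t : Finset ℕ} (hs : s ∈ A) (hts : t ⊆ s) :
    ∃ G : EuclideanSpace ℝ (Fin d) × ℝ →ₗ[ℝ] ℝ, (∀ v ∈ t, G (φ v, 1) = 0) ∧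
      ∀ v ∈ V, v ∉ t → 0 < G (φ v, 1) := by
  classical
  choose! p hpA hpsub hpv using S.pivot s hs
  refine ⟨H s + ∑ u ∈ s \ t, H (p u), fun v hv => ?_, fun v hv hvt => ?_⟩
  · rw [LinearMap.add_apply, S.zero s hs v (hts hv), zero_add, LinearMap.sum_apply]
    refine Finset.sum_eq_zero fun u hu => ?_
    obtain ⟨hus, hut⟩ := Finset.mem_sdiff.1 hu
    exact S.zero _ (hpA u hus) v (hpsub u hus (Finset.mem_erase.2
      ⟨fun h => hut (h ▸ hv), hts hv⟩))
  · rw [LinearMap.add_apply, LinearMap.sum_apply]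
    have hnn : ∀ u ∈ s \ t, 0 ≤ H (p u) (φ v, 1) := fun u hu =>
      S.nonneg (hpA u (Finset.mem_sdiff.1 hu).1) hv
    by_cases hvs : v ∈ s
    · refine add_pos_of_nonneg_of_pos (S.nonneg hs hv)
        (Finset.sum_pos' hnn ⟨v, Finset.mem_sdiff.2 ⟨hvs, hvt⟩, ?_⟩)
      exact S.pos _ (hpA v hvs) v hv (hpv v hvs)
    · exact add_pos_of_pos_of_nonneg (S.pos s hs v hv hvs) (Finset.sum_nonneg hnn)

lemma isExposed_face {s t : Finset ℕ} (hs : s ∈ A) (hts : t ⊆ s) (ht : t.Nonempty) :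
    IsExposed ℝ (convexHull ℝ (φ '' (V : Set ℕ))) (convexHull ℝ (φ '' (t : Set ℕ))) := by
  obtain ⟨G, hG0, hGpos⟩ := S.exists_face_functional hs hts
  intro _
  let l : EuclideanSpace ℝ (Fin d) →ₗ[ℝ] ℝ := -(G ∘ₗ LinearMap.inl ℝ _ ℝ)
  have hl : ∀ x, l x = G (0, 1) - G (x, 1) := fun x => by
    have : G (x, 1) = G (x, 0) + G (0, 1) := by rw [← map_add]; simp
    simp [l, this]
  refine ⟨LinearMap.toContinuousLinearMap l, ?_⟩
  refine (maximizers_convexHull_image (l := l) (m := G (0, 1)) (hts.trans (S.subset s hs)) ht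
    (fun v hv => ?_) fun v hv => ?_).symm
  · rw [hl, sub_le_self_iff]
    by_cases hvt : v ∈ t
    · exact (hG0 v hvt).ge
    · exact (hGpos v hv hvt).le
  · rw [hl, sub_eq_self]
    exact ⟨fun h => by_contra fun hvt => (hGpos v hv hvt).ne' h, hG0 v⟩

lemma mem_extremePoints_convexHull {s : Finset ℕ} (hs : s ∈ A) {v : ℕ} (hv : v ∈ s) :
    φ v ∈ (convexHull ℝ (φ '' (V : Set ℕ))).extremePoints ℝ := by
  have h := (S.isExposed_face hs (Finset.singleton_subset_iff.2 hv)
    (Finset.singleton_nonempty v)).isExtreme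
  simpa using h

lemma extremePoints_face {s t : Finset ℕ} (hs : s ∈ A) (hts : t ⊆ s) :
    (convexHull ℝ (φ '' (t : Set ℕ))).extremePoints ℝ = φ '' (t : Set ℕ) := by
  refine subset_antisymm extremePoints_convexHull_subset ?_
  rintro _ ⟨v, hv, rfl⟩
  exact inter_extremePoints_subset_extremePoints_of_subset
    (convexHull_mono (Set.image_mono (Finset.coe_subset.2 (hts.trans (S.subset s hs)))))
    ⟨subset_convexHull ℝ _ ⟨v, hv, rfl⟩, S.mem_extremePoints_convexHull hs (hts hv)⟩

lemma isProperFace_face {s t : Finset ℕ} (hs : s ∈ A) (hts : t ⊆ s) (ht : t.Nonempty) :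
    IsProperFace (convexHull ℝ (φ '' (V : Set ℕ))) (convexHull ℝ (φ '' (t : Set ℕ))) := by
  refine ⟨S.isExposed_face hs hts ht, (ht.to_set.image φ).convexHull, fun h => ?_⟩
  obtain ⟨w, hwV, hws⟩ := S.exists_notMem hs
  have hw : φ w ∈ convexHull ℝ (φ '' (t : Set ℕ)) := h ▸ subset_convexHull ℝ _ ⟨w, hwV, rfl⟩
  obtain ⟨c, -, hc1, hcw⟩ := exists_weights_of_mem_convexHull_image hw
  have : ((φ w, 1) : EuclideanSpace ℝ (Fin d) × ℝ) = ∑ v ∈ t, c v • (φ v, 1) := by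
    ext1 <;> simp [Prod.fst_sum, Prod.snd_sum, hc1, hcw]
  have h0 := S.pos s hs w hwV hws
  rw [this, map_sum, Finset.sum_eq_zero] at h0
  · exact h0.false
  · intro v hv
    rw [map_smul, S.zero s hs v (hts hv), smul_zero]

lemma exists_eq_of_isProperFace {F : Set (EuclideanSpace ℝ (Fin d))}
    (hF : IsProperFace (convexHull ℝ (φ '' (V : Set ℕ))) F) :
    ∃ s ∈ A, ∃ t ⊆ s, t.Nonempty ∧ F = convexHull ℝ (φ '' (t : Set ℕ)) := by
  classical
  obtain ⟨hexp, hne, hneP⟩ := hF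
  obtain ⟨l, hl⟩ := hexp hne
  obtain ⟨x, hx⟩ := hne
  rw [hl] at hx
  obtain ⟨hxP, hmax⟩ := hx
  set m := l x with hm
  have hle : ∀ v ∈ V, l (φ v) ≤ m := fun v hv => hmax _ (subset_convexHull ℝ _ ⟨v, hv, rfl⟩)
  set Z := V.filter fun v => l (φ v) = m with hZ
  have hZV : Z ⊆ V := Finset.filter_subset _ _
  have hZne : Z.Nonempty := by
    by_contra hZe
    rw [Finset.not_nonempty_iff_eq_empty, Finset.filter_eq_empty_iff] at hZe
    have : ∀ y ∈ convexHull ℝ (φ '' (V : Set ℕ)), l y < m := by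
      refine convexHull_min (t := {y | l y < m}) ?_ (convex_halfSpace_lt l.isLinear m)
      rintro _ ⟨v, hv, rfl⟩
      exact lt_of_le_of_ne (hle v hv) (hZe hv)
    exact (this x hxP).false
  have hFZ : F = convexHull ℝ (φ '' (Z : Set ℕ)) := by
    rw [hl]
    exact maximizers_convexHull_image (l := (l : EuclideanSpace ℝ (Fin d) →ₗ[ℝ] ℝ)) (m := m) hZV
      hZne hle fun v hv => by simp [hZ, hv]
  let G : EuclideanSpace ℝ (Fin d) × ℝ →ₗ[ℝ] ℝ :=
    m • LinearMap.snd ℝ _ ℝ - (l : EuclideanSpace ℝ (Fin d) →ₗ[ℝ] ℝ) ∘ₗ LinearMap.fst ℝ _ ℝ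
  have hG : ∀ v, G (φ v, 1) = m - l (φ v) := fun v => by simp [G]
  have hGnn : ∀ v ∈ V, 0 ≤ G (φ v, 1) := fun v hv => by rw [hG]; linarith [hle v hv]
  have hGpos : 0 < G (∑ v ∈ V, (φ v, 1)) := by
    rw [map_sum]
    refine (Finset.sum_nonneg hGnn).lt_of_ne fun h0 => hneP ?_
    rw [eq_comm, Finset.sum_eq_zero_iff_of_nonneg hGnn] at h0
    have : Z = V := Finset.filter_true_of_mem fun v hv => by
      have := h0 v hv
      rw [hG] at this
      linarith
    rw [hFZ, this]
  -- The candidate facet is the one whose cone contains the sum over `Z`, up to a multiple of the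
  -- sum over `V`. Applying `G` gives `a ≤ 0`. Then `H s` is at most zero on the sum over `Z`,
  -- though nonnegative on each of its points, which forces `Z ⊆ s`.
  obtain ⟨s, hs, a, w, hw, hz⟩ := S.exists_nonneg_combination (∑ v ∈ Z, (φ v, 1))
  have ha1 : a ≤ 0 := by
    have h := congrArg G hz
    rw [map_sum, Finset.sum_eq_zero fun v hv => by rw [hG, (Finset.mem_filter.1 hv).2, sub_self],
      map_add, map_smul, smul_eq_mul] at h
    have h' : 0 ≤ G (∑ v ∈ s, w v • (φ v, 1)) := by
      rw [map_sum]
      refine Finset.sum_nonneg fun v hv => ?_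
      rw [map_smul]
      exact mul_nonneg (hw v hv) (hGnn v (S.subset s hs hv))
    by_contra! hpos
    have := mul_pos hpos hGpos
    linarith
  have hHs : H s (∑ v ∈ Z, (φ v, 1)) = a * H s (∑ v ∈ V, (φ v, 1)) := by
    rw [hz, map_add, map_smul, map_sum _ _ s, Finset.sum_eq_zero (s := s), add_zero,
      smul_eq_mul]
    intro u hu
    rw [map_smul, S.zero s hs u hu, smul_zero]
  have hnn : ∀ v ∈ Z, 0 ≤ H s (φ v, 1) := fun v hv => S.nonneg hs (hZV hv)
  have hsum0 : ∑ v ∈ Z, H s (φ v, 1) = 0 := by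
    refine le_antisymm ?_ (Finset.sum_nonneg hnn)
    rw [← map_sum, hHs]
    exact mul_nonpos_of_nonpos_of_nonneg ha1 (S.sum_pos hs).le
  refine ⟨s, hs, Z, fun v hv => ?_, hZne, hFZ⟩
  by_contra hvs
  exact (S.pos s hs v (hZV hv) hvs).ne' ((Finset.sum_eq_zero_iff_of_nonneg hnn).1 hsum0 v hv)

lemma affineIndependent_face {s t : Finset ℕ} (hs : s ∈ A) (hts : t ⊆ s) :
    AffineIndependent ℝ ((↑) : φ '' (t : Set ℕ) → EuclideanSpace ℝ (Fin d)) := by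
  classical
  have h : AffineIndependent ℝ fun v : s => φ v := by
    rw [affineIndependent_iff]
    intro u w hw hwφ v hv
    have h0 := S.coeff_eq_zero hs
      (w := fun v => if h : v ∈ s then (if (⟨v, h⟩ : s) ∈ u then w ⟨v, h⟩ else 0) else 0) (by
        rw [← Finset.sum_coe_sort s]
        calc _ = ∑ v ∈ u, w v • ((φ v, 1) : EuclideanSpace ℝ (Fin d) × ℝ) := by
              rw [← Finset.sum_subset (Finset.subset_univ u)]
              · exact Finset.sum_congr rfl fun v hv => by simp [hv]
              · intro v _ hv
                simp [hv]
          _ = 0 := by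
            ext1 <;> simp [Prod.fst_sum, Prod.snd_sum, hw, hwφ])
    simpa [hv] using h0 v v.2
  have h' := h.range
  refine h'.mono ?_
  rintro _ ⟨v, hv, rfl⟩
  exact ⟨⟨v, hts hv⟩, rfl⟩

lemma affineSpan_convexHull_eq_top : affineSpan ℝ (convexHull ℝ (φ '' (V : Set ℕ))) = ⊤ := by
  classical
  rw [affineSpan_convexHull]
  refine eq_top_iff.2 fun x _ => ?_
  obtain ⟨s, hs, a, w, -, hz⟩ := S.exists_nonneg_combination (x, 1)
  have hz' : ((x, 1) : EuclideanSpace ℝ (Fin d) × ℝ) =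
      ∑ v ∈ V, (a + if v ∈ s then w v else 0) • (φ v, 1) := by
    rw [hz, Finset.smul_sum]
    simp only [add_smul, Finset.sum_add_distrib, ite_smul, zero_smul]
    rw [← Finset.sum_filter, Finset.filter_mem_eq_inter, Finset.inter_eq_right.2 (S.subset s hs)]
  have h1 := congrArg Prod.snd hz'
  have h2 := congrArg Prod.fst hz'
  simp only [Prod.snd_sum, Prod.fst_sum, Prod.smul_snd, Prod.smul_fst, smul_eq_mul, mul_one]
    at h1 h2
  rw [h2, ← Finset.affineCombination_eq_linear_combination _ _ _ h1.symm]
  exact affineCombination_mem_affineSpan_image h1.symm (fun _ h h' => absurd h h') φ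

/-- The convex hull of a configuration with a facet system is a simplicial polytope, and its
boundary complex is spanned by the members of the system. -/
theorem isSimplicialPolytope : IsSimplicialPolytope (convexHull ℝ (φ '' (V : Set ℕ))) := by
  classical
  refine ⟨⟨⟨V.image φ, by rw [Finset.coe_image]⟩, S.affineSpan_convexHull_eq_top⟩, fun F hF => ?_⟩
  obtain ⟨s, hs, t, hts, -, rfl⟩ := S.exists_eq_of_isProperFace hF
  rw [S.extremePoints_face hs hts]
  exact S.affineIndependent_face hs hts

theorem isRealizedAsBoundary :
    IsRealizedAsBoundary (spannedComplex A) (convexHull ℝ (φ '' (V : Set ℕ))) := by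
  refine ⟨φ, ?_, fun τ => ⟨?_, ?_⟩⟩
  · rintro v ⟨-, s, hs, hv⟩ w ⟨-, s', hs', hw⟩ hvw
    by_contra hne
    obtain ⟨G, hG0, hGpos⟩ := S.exists_face_functional hs hv
    have h1 := hGpos w (S.subset s' hs' (Finset.singleton_subset_iff.1 hw))
      (by simpa using Ne.symm hne)
    have h2 := hG0 v (Finset.mem_singleton_self v)
    rw [hvw] at h2
    exact h1.ne' h2
  · rintro ⟨F, hF, hτ⟩
    obtain ⟨s, hs, t, hts, ht, rfl⟩ := S.exists_eq_of_isProperFace hF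
    exact ⟨t, ⟨ht, s, hs, hts⟩, hτ.trans (S.extremePoints_face hs hts)⟩
  · rintro ⟨t, ⟨ht, s, hs, hts⟩, hτ⟩
    exact ⟨_, S.isProperFace_face hs hts ht, hτ.trans (S.extremePoints_face hs hts).symm⟩

end IsFacetSystem

/-! ### Boundary facets of a pure complex and their exchange property. -/

/-- The `d`-sets contained in exactly one member of `I`. -/
def boundaryFacets (d : ℕ) (I : Set (Finset ℕ)) : Set (Finset ℕ) :=
  {s | s.card = d ∧ ∃! f, f ∈ I ∧ s ⊆ f}

lemma boundaryComplex_spannedComplex {d : ℕ} (hd : 0 < d) {I : Set (Finset ℕ)}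
    (hI : ∀ f ∈ I, f.card = d + 1) :
    boundaryComplex d (spannedComplex I) = spannedComplex (boundaryFacets d I) := by
  have hfacet : ∀ f : Finset ℕ, f ∈ (spannedComplex I).faces ∧ f.card = d + 1 ↔ f ∈ I := by
    refine fun f => ⟨?_, fun hf => ⟨⟨Finset.card_pos.1 (by rw [hI f hf]; omega), f, hf, subset_rfl⟩,
      hI f hf⟩⟩
    rintro ⟨⟨-, g, hg, hfg⟩, hcard⟩
    rwa [Finset.eq_of_subset_of_card_le hfg (by rw [hI g hg, hcard])]
  unfold boundaryComplex
  congr 1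
  ext s
  simp only [boundaryFacets, Set.mem_ofPred_eq, ← and_assoc, hfacet]
  constructor
  · rintro ⟨⟨-, h⟩, h'⟩
    exact ⟨h, h'⟩
  · rintro ⟨h, f, ⟨hf, hsf⟩, hu⟩
    exact ⟨⟨⟨Finset.card_pos.1 (h ▸ hd), f, hf, hsf⟩, h⟩, f, ⟨hf, hsf⟩, hu⟩

/-- In a pure complex in which every ridge lies in at most two facets, the facets of the boundary
are closed under exchanging one vertex. -/
lemma exists_boundaryFacets_exchange {d : ℕ} {I : Set (Finset ℕ)} (hfin : I.Finite)
    (hI : ∀ f ∈ I, f.card = d + 1)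
    (htwo : ∀ s : Finset ℕ, s.card = d → ∀ f ∈ I, ∀ g ∈ I, ∀ h ∈ I, s ⊆ f → s ⊆ g → s ⊆ h →
      f = g ∨ f = h ∨ g = h)
    {s : Finset ℕ} (hs : s ∈ boundaryFacets d I) {v : ℕ} (hv : v ∈ s) :
    ∃ s' ∈ boundaryFacets d I, s.erase v ⊆ s' ∧ v ∉ s' := by
  classical
  obtain ⟨hcard, f₀, ⟨hf₀, hsf₀⟩, hu⟩ := hs
  set r := s.erase v with hr
  have hvr : v ∉ r := Finset.notMem_erase v s
  have hrcard : r.card + 1 = d := by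
    rw [hr, Finset.card_erase_add_one hv, hcard]
  set J := hfin.toFinset.filter fun f => r ⊆ f with hJ
  have hmemJ : ∀ f, f ∈ J ↔ f ∈ I ∧ r ⊆ f := fun f => by simp [hJ]
  set U := J.biUnion id \ r with hU
  set D : ℕ → Finset (Finset ℕ) := fun x => J.filter fun f => x ∈ f with hD
  have hmemD : ∀ x f, f ∈ D x ↔ f ∈ I ∧ insert x r ⊆ f := fun x f => by
    rw [hD, Finset.mem_filter, hmemJ, Finset.insert_subset_iff]
    tauto
  -- Double count the pairs `(x, f)` with `insert x r ⊆ f`: every `f` containing `r` has exactly two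
  -- vertices outside `r`.
  have heven : ¬ Odd (∑ x ∈ U, (D x).card) := by
    have hdc : ∑ x ∈ U, (D x).card = ∑ f ∈ J, (U.filter fun x => x ∈ f).card :=
      Finset.sum_card_bipartiteAbove_eq_sum_card_bipartiteBelow fun x f => x ∈ f
    rw [hdc, Finset.sum_congr rfl (g := fun _ => 2) fun f hf => ?_]
    · simp
    · have hfJ := (hmemJ f).1 hf
      have : (U.filter fun x => x ∈ f) = f \ r := by
        ext x
        simp only [hU, Finset.mem_filter, Finset.mem_sdiff, Finset.mem_biUnion, id]
        exact ⟨fun h => ⟨h.2, h.1.2⟩, fun h => ⟨⟨⟨f, hf, h.1⟩, h.2⟩, h.1⟩⟩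
      rw [this, Finset.card_sdiff_of_subset hfJ.2, hI f hfJ.1]
      omega
  rw [Finset.odd_sum_iff_odd_card_odd] at heven
  have hDv : D v = {f₀} := by
    ext f
    rw [hmemD, hr, Finset.insert_erase hv, Finset.mem_singleton]
    exact ⟨fun h => hu f h, fun h => h ▸ ⟨hf₀, hsf₀⟩⟩
  have hv' : v ∈ U.filter fun x => Odd (D x).card := by
    rw [Finset.mem_filter, hDv]
    refine ⟨?_, by simp⟩
    rw [hU, Finset.mem_sdiff, Finset.mem_biUnion]
    exact ⟨⟨f₀, (hmemJ f₀).2 ⟨hf₀, (Finset.erase_subset v s).trans hsf₀⟩, hsf₀ hv⟩, hvr⟩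
  -- The vertices of odd degree are even in number and include `v`, so there is another one, `w`.
  -- Degrees are at most two, so odd degree means that `insert w r` is a boundary facet.
  have hlt : 1 < (U.filter fun x => Odd (D x).card).card := by
    have hpos := Finset.card_pos.2 ⟨v, hv'⟩
    rw [Nat.not_odd_iff_even] at heven
    obtain ⟨c, hc⟩ := heven
    omega
  obtain ⟨w, hw, hwv⟩ := Finset.exists_mem_ne hlt v
  obtain ⟨hwU, hodd⟩ := Finset.mem_filter.1 hw
  have hwr : w ∉ r := (Finset.mem_sdiff.1 hwU).2
  have hwcard : (insert w r).card = d := by rw [Finset.card_insert_of_notMem hwr, hrcard]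
  obtain ⟨f, hf⟩ : (D w).Nonempty := Finset.card_pos.1 hodd.pos
  refine ⟨insert w r, ⟨hwcard, f, (hmemD w f).1 hf, fun g hg => ?_⟩, Finset.subset_insert w r, ?_⟩
  · by_contra hgf
    have hg' := (hmemD w g).2 hg
    have hle : ({g, f} : Finset (Finset ℕ)) ⊆ D w := by
      rw [Finset.insert_subset_iff, Finset.singleton_subset_iff]
      exact ⟨hg', hf⟩
    have h2 : D w = {g, f} := by
      refine (hle.antisymm fun h hh => ?_).symm
      have h1 := (hmemD w h).1 hh
      have h2 := (hmemD w f).1 hf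
      rw [Finset.mem_insert, Finset.mem_singleton]
      rcases htwo _ hwcard g hg.1 f h2.1 h h1.1 hg.2 h2.2 h1.2 with h | h | h
      · exact absurd h hgf
      · exact Or.inl h.symm
      · exact Or.inr h.symm
    rw [h2, Finset.card_pair hgf] at hodd
    exact absurd hodd (by decide)
  · rw [Finset.mem_insert, not_or]
    exact ⟨hwv.symm, hvr⟩

/-! ### Blocks and their adjacencies. -/

/-- The members of `F4`. -/
def block (i j : ℕ) : Finset ℕ := {0, i, i + 1, j, j + 1}

lemma mem_block {i j k : ℕ} :
    k ∈ block i j ↔ k = 0 ∨ k = i ∨ k = i + 1 ∨ k = j ∨ k = j + 1 := by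
  simp [block]

lemma mem_F4 {n : ℕ} {f : Finset ℕ} :
    f ∈ F4 n ↔ ∃ i j, 1 ≤ i ∧ i + 2 ≤ j ∧ j < n ∧ f = block i j := by
  constructor
  · rintro ⟨_, ⟨i, j, hi, hij, hj, rfl⟩, rfl⟩
    exact ⟨i, j, hi, hij, hj, by ext; simp [block]; tauto⟩
  · rintro ⟨i, j, hi, hij, hj, rfl⟩
    exact ⟨_, ⟨i, j, hi, hij, hj, rfl⟩, by ext; simp [block]; tauto⟩

lemma card_block {i j : ℕ} (hi : 1 ≤ i) (hij : i + 2 ≤ j) : (block i j).card = 5 := by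
  unfold block
  rw [Finset.card_insert_of_notMem, Finset.card_insert_of_notMem, Finset.card_insert_of_notMem,
    Finset.card_pair] <;> simp <;> omega

lemma block_injective {i j i' j' : ℕ} (hi : 1 ≤ i) (hij : i + 2 ≤ j) (hi' : 1 ≤ i')
    (hij' : i' + 2 ≤ j') (h : block i j = block i' j') : i = i' ∧ j = j' := by
  have h1 := mem_block.1 (h ▸ mem_block.2 (by simp) : i ∈ block i' j')
  have h2 := mem_block.1 (h ▸ mem_block.2 (by simp) : i + 1 ∈ block i' j')
  have h3 := mem_block.1 (h ▸ mem_block.2 (by simp) : j ∈ block i' j')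
  have h4 := mem_block.1 (h ▸ mem_block.2 (by simp) : j + 1 ∈ block i' j')
  omega

lemma componentwiseLE_block {i j i' j' : ℕ} (hi : 1 ≤ i) (hij : i + 2 ≤ j) (hi' : 1 ≤ i')
    (hij' : i' + 2 ≤ j') (h : i' ≤ i) (h' : j' ≤ j) :
    ComponentwiseLE 5 (block i' j') (block i j) := by
  have key : ∀ i j : ℕ, 1 ≤ i → i + 2 ≤ j → StrictMono ![0, i, i + 1, j, j + 1] ∧
      block i j = Finset.univ.image ![0, i, i + 1, j, j + 1] := fun i j hi hij => by
    constructor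
    · rw [Fin.strictMono_iff_lt_succ]
      intro k
      fin_cases k <;> simp <;> omega
    · ext k
      simp [block, Fin.exists_fin_succ, eq_comm]
  refine ⟨_, _, (key i' j' hi' hij').1, (key i j hi hij).1, (key i' j' hi' hij').2,
    (key i j hi hij).2, fun k => ?_⟩
  fin_cases k <;> simp <;> omega

/-- The blocks sharing a ridge with a given block. -/
lemma block_erase_subset {i j i' j' x : ℕ} (hi : 1 ≤ i) (hij : i + 2 ≤ j) (hij' : i' + 2 ≤ j')
    (hx : x ∈ block i j) (h : (block i j).erase x ⊆ block i' j') :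
    (i' = i ∧ j' = j) ∨ (x = i ∧ i' = i + 1 ∧ (j' = j ∨ j' = j + 1 ∧ j = i + 2)) ∨
      (x = i + 1 ∧ i' + 1 = i ∧ j' = j) ∨ (x = j ∧ i' = i ∧ j' = j + 1) ∨
      (x = j + 1 ∧ (i' = i ∧ j' + 1 = j ∨ j = i + 2 ∧ i' + 1 = i ∧ j' = i + 1)) := by
  have h' : ∀ k, k ∈ block i j → 1 ≤ k → k ≠ x → k = i' ∨ k = i' + 1 ∨ k = j' ∨ k = j' + 1 :=
    fun k hk hk0 hkx => (mem_block.1 (h (Finset.mem_erase.2 ⟨hkx, hk⟩))).resolve_left (by omega)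
  have h1 := h' i (mem_block.2 (by simp)) hi
  have h2 := h' (i + 1) (mem_block.2 (by simp)) (by omega)
  have h3 := h' j (mem_block.2 (by simp)) (by omega)
  have h4 := h' (j + 1) (mem_block.2 (by simp)) (by omega)
  clear h h'
  rcases mem_block.1 hx with rfl | rfl | rfl | rfl | rfl
  · replace h1 := h1 (by omega)
    replace h2 := h2 (by omega)
    replace h3 := h3 (by omega)
    replace h4 := h4 (by omega)
    left
    omega
  · replace h2 := h2 (by omega)
    replace h3 := h3 (by omega)
    replace h4 := h4 (by omega)
    clear h1
    rcases h2 with h | h | h | h <;> rcases h3 with h' | h' | h' | h' <;> omega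
  · replace h1 := h1 (by omega)
    replace h3 := h3 (by omega)
    replace h4 := h4 (by omega)
    clear h2
    rcases h1 with h | h | h | h <;> rcases h3 with h' | h' | h' | h' <;> omega
  · replace h1 := h1 (by omega)
    replace h2 := h2 (by omega)
    replace h4 := h4 (by omega)
    clear h3
    rcases h1 with h | h | h | h <;> rcases h2 with h' | h' | h' | h' <;> omega
  · replace h1 := h1 (by omega)
    replace h2 := h2 (by omega)
    replace h3 := h3 (by omega)
    clear h4
    rcases h1 with h | h | h | h <;> rcases h2 with h' | h' | h' | h' <;> omega

lemma exists_eq_erase {d : ℕ} {s f : Finset ℕ} (hs : s.card = d) (hf : f.card = d + 1)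
    (hsf : s ⊆ f) : ∃ x ∈ f, s = f.erase x := by
  obtain ⟨x, hx⟩ := Finset.card_eq_one.1
    (by rw [Finset.card_sdiff_of_subset hsf, hs, hf]; omega : (f \ s).card = 1)
  have hxf : x ∈ f := (Finset.mem_sdiff.1 (hx ▸ Finset.mem_singleton_self x)).1
  refine ⟨x, hxf, ?_⟩
  rw [← Finset.sdiff_singleton_eq_erase, ← hx, Finset.sdiff_sdiff_eq_self hsf]

/-- The alternatives in `block_erase_subset` exclude one another because `i' + 2 ≤ j'`, so at most
one other block lies across each vertex. -/
lemma ridge_in_at_most_two {n : ℕ} (s : Finset ℕ) (hs : s.card = 4) {f g h : Finset ℕ}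
    (hf : f ∈ F4 n) (hg : g ∈ F4 n) (hh : h ∈ F4 n) (hsf : s ⊆ f) (hsg : s ⊆ g) (hsh : s ⊆ h) :
    f = g ∨ f = h ∨ g = h := by
  obtain ⟨i, j, hi, hij, -, rfl⟩ := mem_F4.1 hf
  obtain ⟨i', j', hi', hij', -, rfl⟩ := mem_F4.1 hg
  obtain ⟨i'', j'', hi'', hij'', -, rfl⟩ := mem_F4.1 hh
  obtain ⟨x, hx, rfl⟩ := exists_eq_erase hs (card_block hi hij) hsf
  have h1 := block_erase_subset hi hij hij' hx hsg
  have h2 := block_erase_subset hi hij hij'' hx hsh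
  have : (i = i' ∧ j = j') ∨ (i = i'' ∧ j = j'') ∨ (i' = i'' ∧ j' = j'') := by omega
  rcases this with ⟨rfl, rfl⟩ | ⟨rfl, rfl⟩ | ⟨rfl, rfl⟩ <;> simp

/-! ### Parameters whose sums follow a prescribed staircase. -/

lemma two_mul_two_pow_le {a b : ℕ} (h : a < b) : 2 * (2 : ℝ) ^ a ≤ 2 ^ b := by
  have : (2 : ℝ) ^ (a + 1) ≤ 2 ^ b := pow_le_pow_right₀ (by norm_num) h
  rw [pow_succ] at this
  linarith

/-- Every staircase is the sign pattern of the sums of two pairs of consecutive terms of an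
increasing sequence. -/
lemma exists_seq_sign_pattern (n : ℕ) (R : ℕ → ℕ → Prop)
    (hR : ∀ i j, R i j → 1 ≤ i ∧ i + 2 ≤ j ∧ j < n)
    (hdown : ∀ i j i' j', R i j → 1 ≤ i' → i' ≤ i → i' + 2 ≤ j' → j' ≤ j → R i' j')
    (hne : ∃ i j, R i j) :
    ∃ (t : ℕ → ℝ) (N : ℕ), (∀ i j, 1 ≤ i → i < j → t i < t j) ∧
      (∀ i j, R i j → t i + t (i + 1) + t j + t (j + 1) < 0) ∧
      (∀ i j, 1 ≤ i → i + 2 ≤ j → ¬ R i j → 0 < t i + t (i + 1) + t j + t (j + 1)) ∧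
      R 1 N ∧ (∀ i j, R i j → j ≤ N) ∧ t 1 + t N + 2 * t (N + 1) < 0 := by
  classical
  obtain ⟨i₀, j₀, h₀⟩ := hne
  have h13 : R 1 3 := by
    have := hR _ _ h₀
    exact hdown _ _ _ _ h₀ le_rfl (by omega) le_rfl (by omega)
  obtain ⟨p, hp, hpmax⟩ : ∃ p, R p (p + 2) ∧ ∀ i j, R i j → i ≤ p := by
    have h1n : 1 ≤ n := by have := hR _ _ h13; omega
    refine ⟨Nat.findGreatest (fun p => R p (p + 2)) n,
      Nat.findGreatest_spec (P := fun p => R p (p + 2)) h1n h13, fun i j hij => ?_⟩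
    have h := hR _ _ hij
    exact Nat.le_findGreatest (by omega) (hdown _ _ _ _ hij (by omega) le_rfl le_rfl (by omega))
  have hp1 := (hR _ _ hp).1
  obtain ⟨m, hm, hm'⟩ : ∃ m : ℕ → ℕ, (∀ i, 1 ≤ i → i ≤ p → R i (m i)) ∧
      ∀ i, 1 ≤ i → i ≤ p → ∀ j, i + 2 ≤ j → (R i j ↔ j ≤ m i) := by
    have key : ∀ i, 1 ≤ i → i ≤ p → R i (Nat.findGreatest (R i) n) := fun i hi hip => by
      have h : R i (i + 2) := hdown _ _ _ _ hp hi hip le_rfl (by omega)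
      have := hR _ _ h
      exact Nat.findGreatest_spec (by omega : i + 2 ≤ n) h
    refine ⟨fun i => Nat.findGreatest (R i) n, key, fun i hi hip j hj => ⟨fun h => ?_, fun h => ?_⟩⟩
    · have := hR _ _ h
      exact Nat.le_findGreatest (by omega) h
    · exact hdown _ _ _ _ (key i hi hip) hi le_rfl hj h
  have hmp : ∀ i, 1 ≤ i → i ≤ p → p + 2 ≤ m i := fun i hi hip =>
    (hm' i hi hip _ (by omega)).1 (hdown _ _ _ _ hp hi hip (by omega) le_rfl)
  have hmanti : ∀ i i', 1 ≤ i → i ≤ i' → i' ≤ p → m i' ≤ m i := fun i i' hi hii hip => by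
    have := hmp i' (by omega) hip
    exact (hm' i hi (by omega) _ (by omega)).1
      (hdown _ _ _ _ (hm i' (by omega) hip) hi hii (by omega) le_rfl)
  -- For `1 ≤ k ≤ p` the power `2 ^ a k` lies strictly between `t (m k + 1)` and `t (m k + 2)`, so
  -- `t k` outweighs positive terms exactly up to index `m k + 1`. The summand `p + 2 - k` breaks
  -- ties where `m` is constant and stays below the gap `p + 2`. At `k = p + 1` the value `p + 1`
  -- replaces `m k`, so that `t (p + 1)` outweighs `t (p + 2)` but not `t (p + 3)`.
  set a : ℕ → ℕ := fun k => (p + 2) * ((if k ≤ p then m k else p + 1) + 1) + (p + 2 - k) with ha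
  have ha1 : ∀ i, 1 ≤ i → i ≤ p → a i = (p + 2) * (m i + 1) + (p + 2 - i) := fun i _ h => by
    simp [ha, h]
  have ha2 : a (p + 1) = (p + 2) * (p + 2) + 1 := by simp [ha]
  have hstep : ∀ {x y : ℕ}, x < y → (p + 2) * x + (p + 2) ≤ (p + 2) * y := fun {x y} h => by
    have := Nat.mul_le_mul_left (p + 2) (Nat.succ_le_of_lt h)
    rw [Nat.succ_eq_add_one, mul_add, mul_one] at this
    exact this
  have hanti : ∀ i j, 1 ≤ i → i < j → j ≤ p + 1 → a j < a i := fun i j hi hij hj => by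
    rcases Nat.lt_or_ge p j with h | h
    · obtain rfl : j = p + 1 := by omega
      rw [ha1 i hi (by omega), ha2]
      have := hstep (x := p + 2) (y := m i + 1) (by have := hmp i hi (by omega); omega)
      omega
    · rw [ha1 i hi (by omega), ha1 j (by omega) h]
      have := Nat.mul_le_mul_left (p + 2) (Nat.succ_le_succ (hmanti i j hi hij.le h))
      simp only [Nat.succ_eq_add_one] at this
      omega
  set t : ℕ → ℝ := fun k => if k ≤ p + 1 then -(2 : ℝ) ^ a k else 2 ^ ((p + 2) * k) with ht
  have tneg : ∀ k, k ≤ p + 1 → t k = -(2 : ℝ) ^ a k := fun k hk => by simp [ht, hk]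
  have tpos : ∀ k, p + 2 ≤ k → t k = 2 ^ ((p + 2) * k) := fun k hk => by
    simp [ht, show ¬ k ≤ p + 1 by omega]
  have hpow : ∀ e : ℕ, (0 : ℝ) < 2 ^ e := fun e => by positivity
  have hmono : ∀ i j, 1 ≤ i → i < j → t i < t j := fun i j hi hij => by
    rcases Nat.lt_or_ge (p + 1) j with h | h
    · rw [tpos j (by omega)]
      rcases Nat.lt_or_ge (p + 1) i with h' | h'
      · rw [tpos i (by omega)]
        exact pow_lt_pow_right₀ (by norm_num) (by have := hstep hij; omega)
      · rw [tneg i h']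
        linarith [hpow (a i), hpow ((p + 2) * j)]
    · rw [tneg i (by omega), tneg j h]
      exact neg_lt_neg (pow_lt_pow_right₀ (by norm_num) (hanti i j hi hij h))
  refine ⟨t, m 1, hmono, fun i j hij => ?_, fun i j hi hij hn => ?_, hm 1 le_rfl hp1,
    fun i j hij => ?_, ?_⟩
  · have hb := hR _ _ hij
    have hip := hpmax _ _ hij
    have e1 := tneg i (by omega)
    have e2 := tneg (i + 1) (by omega)
    rcases lt_trichotomy j (p + 1) with h | h | h
    · rw [e1, e2, tneg j (by omega), tneg (j + 1) (by omega)]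
      linarith [hpow (a i), hpow (a (i + 1)), hpow (a j), hpow (a (j + 1))]
    · subst h
      rw [e1, e2, tneg (p + 1) le_rfl, tpos (p + 1 + 1) le_rfl, ha2]
      have := two_mul_two_pow_le (a := (p + 2) * (p + 1 + 1)) (b := (p + 2) * (p + 2) + 1)
        (Nat.lt_succ_self _)
      linarith [hpow (a i), hpow (a (i + 1)), hpow ((p + 2) * (p + 1 + 1))]
    · have hlt := hmono j (j + 1) (by omega) (by omega)
      have hj := (hm' i hb.1 hip j hb.2.1).1 hij
      rw [tpos (j + 1) (by omega)] at hlt ⊢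
      rw [e1, e2]
      have := two_mul_two_pow_le (a := (p + 2) * (j + 1)) (b := a i) (by
        rw [ha1 i hb.1 hip]
        have := Nat.mul_le_mul_left (p + 2) (Nat.succ_le_succ hj)
        simp only [Nat.succ_eq_add_one] at this
        omega)
      linarith [hpow (a (i + 1))]
  · rcases lt_trichotomy i (p + 1) with h | h | h
    · have e1 := tneg i (by omega)
      have e2 := tneg (i + 1) (by omega)
      have hj : m i < j := by
        by_contra hc
        exact hn ((hm' i hi (by omega) j hij).2 (by omega))
      have hj' := hmp i hi (by omega)
      rw [e1, e2, tpos j (by omega), tpos (j + 1) (by omega)]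
      have h1 := two_mul_two_pow_le (a := a i) (b := (p + 2) * (j + 1)) (by
        rw [ha1 i hi (by omega)]
        have := hstep (x := m i + 1) (y := j + 1) (by omega)
        omega)
      have h2 := two_mul_two_pow_le (hanti i (i + 1) hi (by omega) (by omega))
      linarith [hpow ((p + 2) * j), hpow (a i), hpow (a (i + 1))]
    · subst h
      rw [tneg (p + 1) le_rfl, ha2, tpos (p + 1 + 1) le_rfl, tpos j (by omega),
        tpos (j + 1) (by omega)]
      have h1 : (2 : ℝ) ^ ((p + 2) * (p + 2) + 1) ≤ 2 ^ ((p + 2) * j) :=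
        pow_le_pow_right₀ (by norm_num) (by
          have := hstep (x := p + 2) (y := j) (by omega)
          omega)
      linarith [hpow ((p + 2) * (p + 1 + 1)), hpow ((p + 2) * (j + 1))]
    · rw [tpos i h, tpos (i + 1) (by omega), tpos j (by omega), tpos (j + 1) (by omega)]
      positivity
  · have hb := hR _ _ hij
    exact (hm' 1 le_rfl hp1 j (by omega)).1 (hdown _ _ _ _ hij le_rfl hb.1 (by omega) le_rfl)
  · have h := hmp 1 le_rfl hp1
    have hlt := hmono (m 1) (m 1 + 1) (by omega) (by omega)
    rw [tpos (m 1 + 1) (by omega)] at hlt ⊢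
    rw [tneg 1 (by omega), ha1 1 le_rfl hp1]
    have h1 := two_mul_two_pow_le (a := (p + 2) * (m 1 + 1)) (b := (p + 2) * (m 1 + 1) + 1)
      (Nat.lt_succ_self _)
    -- As `p ≥ 1`, the tie-breaking exponent at `k = 1` is at least 2, so `-t 1 ≥ 4 * t (m 1 + 1)`.
    have h2 := two_mul_two_pow_le (a := (p + 2) * (m 1 + 1) + 1)
      (b := (p + 2) * (m 1 + 1) + (p + 2 - 1)) (by omega)
    linarith [hpow ((p + 2) * (m 1 + 1))]

/-! ### Supporting functionals on the moment curve. -/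

/-- The linear form on `ℝ⁴ × ℝ` given by the coefficients of `(X - a) (X - b) (X - c) (X - e)`. -/
def quarticForm (a b c e : ℝ) : EuclideanSpace ℝ (Fin 4) × ℝ →ₗ[ℝ] ℝ where
  toFun z := z.1 3 - (a + b + c + e) * z.1 2
    + (a * b + a * c + a * e + b * c + b * e + c * e) * z.1 1
    - (a * b * c + a * b * e + a * c * e + b * c * e) * z.1 0 + a * b * c * e * z.2
  map_add' z z' := by simp; ring
  map_smul' r z := by simp; ring

/-- Points on the moment curve, together with a distant point as the vertex `0`. -/
def liftedPoint (t : ℕ → ℝ) (M : ℝ) (k : ℕ) : EuclideanSpace ℝ (Fin 4) :=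
  if k = 0 then !₂[0, 0, M, 0] else !₂[t k, t k ^ 2, t k ^ 3, t k ^ 4]

/-- Vertex `0` lies on the cubic axis, so `M` meets only the coefficient of `X ^ 3`, which is minus
the sum of the roots. -/
lemma quarticForm_zero (t : ℕ → ℝ) (M a b c e : ℝ) :
    quarticForm a b c e (liftedPoint t M 0, 1) = a * b * c * e - (a + b + c + e) * M := by
  simp [quarticForm, liftedPoint]
  ring

lemma quarticForm_pos (t : ℕ → ℝ) (M a b c e : ℝ) {k : ℕ} (hk : 1 ≤ k) :
    quarticForm a b c e (liftedPoint t M k, 1) =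
      (t k - a) * (t k - b) * (t k - c) * (t k - e) := by
  simp [quarticForm, liftedPoint, show k ≠ 0 by omega]
  ring

/-- Gale evenness: no vertex parameter lies strictly between two consecutive ones. -/
lemma mul_sub_consecutive_pos {t : ℕ → ℝ} (ht : ∀ i j, 1 ≤ i → i < j → t i < t j) {i k : ℕ}
    (hi : 1 ≤ i) (hk : 1 ≤ k) (h : k ≠ i) (h' : k ≠ i + 1) :
    0 < (t k - t i) * (t k - t (i + 1)) := by
  rcases Nat.lt_or_ge k i with hlt | hge
  · exact mul_pos_of_neg_of_neg (sub_neg.2 (ht k i hk hlt)) (sub_neg.2 (ht k _ hk (by omega)))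
  · exact mul_pos (sub_pos.2 (ht i k hi (by omega))) (sub_pos.2 (ht _ k (by omega) (by omega)))

/-- The form belonging to the pairs `{i, i + 1}` and `{j, j + 1}`. -/
def blockForm (t : ℕ → ℝ) (i j : ℕ) : EuclideanSpace ℝ (Fin 4) × ℝ →ₗ[ℝ] ℝ :=
  quarticForm (t i) (t (i + 1)) (t j) (t (j + 1))

lemma blockForm_sign {t : ℕ → ℝ} (ht : ∀ i j, 1 ≤ i → i < j → t i < t j) (M : ℝ) {i j k : ℕ}
    (hi : 1 ≤ i) (hij : i + 2 ≤ j) (hk : 1 ≤ k) :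
    (k ∈ block i j → blockForm t i j (liftedPoint t M k, 1) = 0) ∧
      (k ∉ block i j → 0 < blockForm t i j (liftedPoint t M k, 1)) := by
  rw [blockForm, quarticForm_pos _ _ _ _ _ _ hk, mem_block]
  constructor
  · rintro (rfl | rfl | rfl | rfl | rfl)
    · omega
    all_goals ring
  · intro h
    simp only [not_or] at h
    rw [mul_assoc]
    exact mul_pos (mul_sub_consecutive_pos ht hi hk h.2.1 h.2.2.1)
      (mul_sub_consecutive_pos ht (by omega) hk h.2.2.2.1 h.2.2.2.2)

/-- The form belonging to `1`, the pair `{j, j + 1}` and a number `T` beyond all parameters. -/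
lemma neg_quarticForm_sign {t : ℕ → ℝ} (ht : ∀ i j, 1 ≤ i → i < j → t i < t j) (M : ℝ) {T : ℝ}
    {j k : ℕ} (hj : 1 ≤ j) (hk : 1 ≤ k) (hT : t k < T) :
    ((k = 1 ∨ k = j ∨ k = j + 1) →
      (-quarticForm (t 1) (t j) (t (j + 1)) T) (liftedPoint t M k, 1) = 0) ∧
    (¬(k = 1 ∨ k = j ∨ k = j + 1) →
      0 < (-quarticForm (t 1) (t j) (t (j + 1)) T) (liftedPoint t M k, 1)) := by
  rw [LinearMap.neg_apply, quarticForm_pos _ _ _ _ _ _ hk]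
  constructor
  · rintro (rfl | rfl | rfl) <;> ring
  · intro h
    simp only [not_or] at h
    have h1 : 0 < t k - t 1 := sub_pos.2 (ht 1 k le_rfl (by omega))
    have h2 := mul_sub_consecutive_pos ht hj hk h.2.1 h.2.2
    have h3 := mul_pos (mul_pos h1 h2) (sub_pos.2 hT)
    linarith

/-- The hyperplane is turned about the common zeros of `G₁` and `G₂` until it passes through vertex
`0`. The opposite signs there make both weights positive, so the zeros away from `0` are exactly the
common ones. -/
lemma exists_combined_form {W : Type*} [AddCommGroup W] [Module ℝ W] {V s : Finset ℕ}
    {x : ℕ → W} {P Q : ℕ → Prop} (G₁ G₂ : W →ₗ[ℝ] ℝ) (h₁ : 0 < G₁ (x 0)) (h₂ : G₂ (x 0) < 0)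
    (hP : ∀ k ∈ V, 1 ≤ k → (P k → G₁ (x k) = 0) ∧ (¬P k → 0 < G₁ (x k)))
    (hQ : ∀ k ∈ V, 1 ≤ k → (Q k → G₂ (x k) = 0) ∧ (¬Q k → 0 < G₂ (x k)))
    (hs : ∀ k ∈ V, k ∈ s ↔ k = 0 ∨ P k ∧ Q k) :
    ∃ H : W →ₗ[ℝ] ℝ, ∀ k ∈ V, (k ∈ s → H (x k) = 0) ∧ (k ∉ s → 0 < H (x k)) := by
  refine ⟨(-G₂ (x 0)) • G₁ + G₁ (x 0) • G₂, fun k hk => ?_⟩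
  rw [hs k hk]
  simp only [LinearMap.add_apply, LinearMap.smul_apply, smul_eq_mul]
  rcases Nat.eq_zero_or_pos k with rfl | hk1
  · exact ⟨fun _ => by ring, fun h => absurd (Or.inl rfl) h⟩
  · obtain ⟨hP0, hP1⟩ := hP k hk hk1
    obtain ⟨hQ0, hQ1⟩ := hQ k hk hk1
    have hk0 : k ≠ 0 := by omega
    refine ⟨fun h => ?_, fun h => ?_⟩
    · obtain ⟨hp, hq⟩ := h.resolve_left hk0
      rw [hP0 hp, hQ0 hq, mul_zero, mul_zero, add_zero]
    · by_cases hp : P k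
      · have hq : ¬Q k := fun hq => h (Or.inr ⟨hp, hq⟩)
        rw [hP0 hp, mul_zero, zero_add]
        exact mul_pos h₁ (hQ1 hq)
      · refine add_pos_of_pos_of_nonneg (mul_pos (by linarith) (hP1 hp)) (mul_nonneg h₁.le ?_)
        by_cases hq : Q k
        · exact (hQ0 hq).ge
        · exact (hQ1 hq).le

lemma eventually_sign (c S : ℝ) :
    ∀ᶠ M : ℝ in Filter.atTop, (S < 0 → 0 < c - S * M) ∧ (0 < S → c - S * M < 0) := by
  rcases lt_trichotomy S 0 with h | h | h
  · filter_upwards [Filter.eventually_gt_atTop (c / S)] with M hM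
    rw [div_lt_iff_of_neg h] at hM
    exact ⟨fun _ => by linarith, fun h' => absurd h h'.not_gt⟩
  · exact Filter.Eventually.of_forall fun M => ⟨fun h' => absurd h h'.ne, fun h' => absurd h h'.ne'⟩
  · filter_upwards [Filter.eventually_gt_atTop (c / S)] with M hM
    rw [div_lt_iff₀ h] at hM
    exact ⟨fun h' => absurd h h'.not_gt, fun _ => by linarith⟩

/-- The supporting form of a facet of the squeezed sphere. -/
lemma exists_facet_form {I : Set (Finset ℕ)} {t : ℕ → ℝ} {M T : ℝ} {N : ℕ}
    (hI : ∀ f ∈ I, ∃ i j, 1 ≤ i ∧ i + 2 ≤ j ∧ j ≤ N ∧ f = block i j)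
    (hdown : ∀ i j i' j', 1 ≤ i' → i' ≤ i → i' + 2 ≤ j' → j' ≤ j → i + 2 ≤ j →
      block i j ∈ I → block i' j' ∈ I)
    (ht : ∀ i j, 1 ≤ i → i < j → t i < t j) (hT : t (N + 1) < T)
    (hin : ∀ i j, 1 ≤ i → i + 2 ≤ j → j ≤ N + 1 → block i j ∈ I →
      0 < blockForm t i j (liftedPoint t M 0, 1))
    (hout : ∀ i j, 1 ≤ i → i + 2 ≤ j → j ≤ N + 1 → block i j ∉ I →
      blockForm t i j (liftedPoint t M 0, 1) < 0)
    (htop : ∀ j, 2 ≤ j → j ≤ N →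
      (-quarticForm (t 1) (t j) (t (j + 1)) T) (liftedPoint t M 0, 1) < 0)
    {s : Finset ℕ} (hs : s ∈ boundaryFacets 4 I) :
    ∃ H : EuclideanSpace ℝ (Fin 4) × ℝ →ₗ[ℝ] ℝ, ∀ k ∈ Finset.range (N + 2),
      (k ∈ s → H (liftedPoint t M k, 1) = 0) ∧ (k ∉ s → 0 < H (liftedPoint t M k, 1)) := by
  obtain ⟨hcard, f, ⟨hf, hsf⟩, hu⟩ := hs
  obtain ⟨i, j, hi, hij, hj, rfl⟩ := hI f hf
  obtain ⟨x, hx, rfl⟩ := exists_eq_erase hcard (card_block hi hij) hsf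
  -- The ridge lies in no member of `I` but `block i j`, so any other block containing it is outside
  -- `I` and has a functional negative at `0`.
  have hu' : ∀ i' j', 1 ≤ i' → i' + 2 ≤ j' → (∀ k, k ∈ block i j → k ≠ x → k ∈ block i' j') →
      i' ≠ i ∨ j' ≠ j → block i' j' ∉ I := by
    intro i' j' hi' hij' hsub hne hmem
    have h := block_injective hi' hij' hi hij (hu _ ⟨hmem, fun k hk =>
      hsub k (Finset.mem_of_mem_erase hk) (Finset.ne_of_mem_erase hk)⟩)
    omega
  have hpos := hin i j hi hij (by omega) hf
  have hsign : ∀ i' j', 1 ≤ i' → i' + 2 ≤ j' → ∀ k ∈ Finset.range (N + 2), 1 ≤ k →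
      (k ∈ block i' j' → blockForm t i' j' (liftedPoint t M k, 1) = 0) ∧
      (k ∉ block i' j' → 0 < blockForm t i' j' (liftedPoint t M k, 1)) :=
    fun i' j' hi' hij' k _ hk => blockForm_sign ht M hi' hij' hk
  have hcross : ∀ i' j', 1 ≤ i' → i' + 2 ≤ j' → j' ≤ N + 1 → i' ≠ i ∨ j' ≠ j →
      (∀ k, (k ∈ block i j ∧ k ≠ x) ↔ k = 0 ∨ k ∈ block i j ∧ k ∈ block i' j') → _ :=
    fun i' j' hi' hij' hj' hne hiff => exists_combined_form (V := Finset.range (N + 2))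
      (s := (block i j).erase x) (x := fun k => (liftedPoint t M k, (1 : ℝ)))
      (blockForm t i j) (blockForm t i' j') hpos
      (hout i' j' hi' hij' hj' (hu' i' j' hi' hij'
        (fun k hk hkx => ((hiff k).1 ⟨hk, hkx⟩).elim (fun h => mem_block.2 (Or.inl h)) And.right)
        hne))
      (hsign i j hi hij) (hsign i' j' hi' hij')
      fun k _ => by rw [Finset.mem_erase, and_comm, hiff]
  have htopform : ∀ j', 2 ≤ j' → j' ≤ N →
      (∀ k, (k ∈ block i j ∧ k ≠ x) ↔ k = 0 ∨ k ∈ block i j ∧ (k = 1 ∨ k = j' ∨ k = j' + 1)) → _ :=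
    fun j' hj1 hj2 hiff => exists_combined_form (V := Finset.range (N + 2))
      (s := (block i j).erase x) (x := fun k => (liftedPoint t M k, (1 : ℝ)))
      (blockForm t i j) (-quarticForm (t 1) (t j') (t (j' + 1)) T) hpos (htop j' hj1 hj2)
      (hsign i j hi hij)
      (fun k hk hk1 => neg_quarticForm_sign ht M (by omega) hk1 (by
        rcases Nat.lt_or_ge k (N + 1) with h | h
        · exact (ht k (N + 1) hk1 h).trans hT
        · obtain rfl : k = N + 1 := by have := Finset.mem_range.1 hk; omega
          exact hT))
      fun k _ => by rw [Finset.mem_erase, and_comm, hiff]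
  rcases mem_block.1 hx with rfl | rfl | rfl | rfl | rfl
  · refine ⟨blockForm t i j, fun k hk => ?_⟩
    rcases Nat.eq_zero_or_pos k with rfl | hk1
    · exact ⟨fun h => absurd h (by simp), fun _ => hpos⟩
    · rw [Finset.mem_erase, and_iff_right (by omega : k ≠ 0)]
      exact hsign i j hi hij k hk hk1
  -- Here `x` is the former `i`. If `j = i + 2`, moving the first pair up pushes the second pair up
  -- as well.
  · rcases Nat.lt_or_ge j (x + 3) with h | h
    · exact hcross (x + 1) (j + 1) (by omega) (by omega) (by omega) (by omega)
        fun k => by simp only [mem_block]; omega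
    · exact hcross (x + 1) j (by omega) (by omega) (by omega) (by omega)
        fun k => by simp only [mem_block]; omega
  -- For `i > 1` the neighbouring block is smaller, hence in `I`, and the ridge would be interior.
  -- For `i = 1` no block lies across it, and the functional with roots at `1`, the pair and `T`
  -- takes over.
  · rcases Nat.lt_or_ge 1 i with h | h
    · exact absurd (hdown i j (i - 1) j (by omega) (by omega) (by omega) le_rfl hij hf)
        (hu' (i - 1) j (by omega) (by omega)
          (fun k => by simp only [mem_block]; omega) (by omega))
    · exact htopform j (by omega) hj fun k => by simp only [mem_block]; omega
  -- The neighbour may use the parameter `t (N + 2)`, which belongs to no vertex.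
  · exact hcross i (x + 1) hi (by omega) (by omega) (by omega)
      fun k => by simp only [mem_block]; omega
  · rcases Nat.lt_or_ge j (i + 3) with h | h
    · rcases Nat.lt_or_ge 1 i with h1 | h1
      · exact absurd (hdown i j (i - 1) (i + 1) (by omega) (by omega) (by omega) (by omega) hij hf)
          (hu' (i - 1) (i + 1) (by omega) (by omega)
            (fun k => by simp only [mem_block]; omega) (by omega))
      -- The ridge is `{0, 1, 2, 3}`, so the pair is `{2, 3}`.
      · exact htopform 2 le_rfl (by omega) fun k => by simp only [mem_block]; omega
    · exact absurd (hdown i j i (j - 1) hi le_rfl (by omega) (by omega) hij hf)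
        (hu' i (j - 1) hi (by omega) (fun k => by simp only [mem_block]; omega) (by omega))

end KalaiSqueezed

/-! ### Choice of the parameters and assembly. -/

theorem theorem2 (n : ℕ) (I : Set (Finset ℕ)) (hI : KalaiSqueezed.IsOrderIdealF4 n I)
    (hne : I.Nonempty) :
    ∃ P : Set (EuclideanSpace ℝ (Fin 4)),
      KalaiSqueezed.IsSimplicialPolytope P ∧
        KalaiSqueezed.IsRealizedAsBoundary (KalaiSqueezed.squeezedSphere I) P := by
  open KalaiSqueezed in
  obtain ⟨hIF, hIdown⟩ := hI
  have hmem : ∀ f ∈ I, ∃ i j, 1 ≤ i ∧ i + 2 ≤ j ∧ j < n ∧ f = block i j :=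
    fun f hf => mem_F4.1 (hIF hf)
  have hbound : ∀ i j, 1 ≤ i → i + 2 ≤ j → block i j ∈ I → j < n := fun i j hi hij h => by
    obtain ⟨i', j', hi', hij', hj', he⟩ := hmem _ h
    obtain ⟨rfl, rfl⟩ := block_injective hi hij hi' hij' he
    exact hj'
  have hdown : ∀ i j i' j', 1 ≤ i' → i' ≤ i → i' + 2 ≤ j' → j' ≤ j → i + 2 ≤ j →
      block i j ∈ I → block i' j' ∈ I := fun i j i' j' hi' hii hij' hjj hij h => by
    have := hbound i j (by omega) hij h
    exact hIdown _ h _ (mem_F4.2 ⟨i', j', hi', hij', by omega, rfl⟩)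
      (componentwiseLE_block (by omega) hij hi' hij' hii hjj)
  obtain ⟨f₀, hf₀⟩ := hne
  obtain ⟨i₀, j₀, hi₀, hij₀, hj₀, rfl⟩ := hmem f₀ hf₀
  obtain ⟨t, N, ht, hneg, hpos, h1N, hN, htop⟩ := exists_seq_sign_pattern n
    (fun i j => 1 ≤ i ∧ i + 2 ≤ j ∧ block i j ∈ I)
    (fun i j h => ⟨h.1, h.2.1, hbound i j h.1 h.2.1 h.2.2⟩)
    (fun i j i' j' h hi' hii hij' hjj =>
      ⟨hi', hij', hdown i j i' j' hi' hii hij' hjj h.2.1 h.2.2⟩)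
    ⟨i₀, j₀, hi₀, hij₀, hf₀⟩
  -- `T` must lie beyond every vertex parameter, yet keep `t 1 + t j + t (j + 1) + T` negative for
  -- all `j ≤ N`; the extreme case is `j = N`.
  obtain ⟨T, hT, hT'⟩ := exists_between (show t (N + 1) < -(t 1 + t N + t (N + 1)) by linarith)
  -- Only finitely many root sums occur, so one large `M` settles all signs at vertex `0`.
  obtain ⟨M, hM⟩ := ((Filter.eventually_all_finset (Finset.range (N + 2))).2 fun i _ =>
    (Filter.eventually_all_finset (Finset.range (N + 2))).2 fun j _ =>
      (eventually_sign (t i * t (i + 1) * t j * t (j + 1))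
        (t i + t (i + 1) + t j + t (j + 1))).and
      (eventually_sign (t 1 * t j * t (j + 1) * T) (t 1 + t j + t (j + 1) + T))).exists
  have hIN : ∀ f ∈ I, ∃ i j, 1 ≤ i ∧ i + 2 ≤ j ∧ j ≤ N ∧ f = block i j := fun f hf => by
    obtain ⟨i, j, hi, hij, -, rfl⟩ := hmem f hf
    exact ⟨i, j, hi, hij, hN i j ⟨hi, hij, hf⟩, rfl⟩
  have hcard : ∀ f ∈ I, f.card = 4 + 1 := fun f hf => by
    obtain ⟨i, j, hi, hij, -, rfl⟩ := hmem f hf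
    exact card_block hi hij
  have hsubset : ∀ f ∈ I, f ⊆ Finset.range (N + 2) := fun f hf k hk => by
    obtain ⟨i, j, hi, hij, hj, rfl⟩ := hIN f hf
    have := mem_block.1 hk
    rw [Finset.mem_range]
    omega
  have hform : ∀ s ∈ boundaryFacets 4 I, ∃ H : EuclideanSpace ℝ (Fin 4) × ℝ →ₗ[ℝ] ℝ,
      ∀ k ∈ Finset.range (N + 2), (k ∈ s → H (liftedPoint t M k, 1) = 0) ∧
        (k ∉ s → 0 < H (liftedPoint t M k, 1)) := by
    refine fun s hs => exists_facet_form hIN hdown ht hT (fun i j hi hij hj h => ?_)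
      (fun i j hi hij hj h => ?_) (fun j hj hjN => ?_) hs
    · rw [blockForm, quarticForm_zero]
      exact (hM i (Finset.mem_range.2 (by omega)) j (Finset.mem_range.2 (by omega))).1.1
        (hneg i j ⟨hi, hij, h⟩)
    · rw [blockForm, quarticForm_zero]
      exact (hM i (Finset.mem_range.2 (by omega)) j (Finset.mem_range.2 (by omega))).1.2
        (hpos i j hi hij fun h' => h h'.2.2)
    · rw [LinearMap.neg_apply, quarticForm_zero, neg_lt_zero]
      refine (hM j (Finset.mem_range.2 (by omega)) j (Finset.mem_range.2 (by omega))).2.1 ?_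
      have hle : t j ≤ t N ∧ t (j + 1) ≤ t (N + 1) := by
        rcases hjN.eq_or_lt with rfl | h
        · exact ⟨le_rfl, le_rfl⟩
        · exact ⟨(ht j N (by omega) h).le, (ht (j + 1) (N + 1) (by omega) (by omega)).le⟩
      linarith
  choose! H hH using hform
  have hsV : ∀ s ∈ boundaryFacets 4 I, s ⊆ Finset.range (N + 2) := by
    rintro s ⟨-, f, ⟨hf, hsf⟩, -⟩
    exact hsf.trans (hsubset f hf)
  have S : IsFacetSystem (Finset.range (N + 2)) (liftedPoint t M) (boundaryFacets 4 I) H :=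
    { dim_pos := by norm_num
      nonempty := by
        refine ⟨(block i₀ j₀).erase 0, ?_, block i₀ j₀, ⟨hf₀, Finset.erase_subset _ _⟩, ?_⟩
        · rw [Finset.card_erase_of_mem (mem_block.2 (by simp)), hcard _ hf₀]
        · rintro f ⟨hf, hsf⟩
          obtain ⟨i, j, hi, hij, -, rfl⟩ := hmem f hf
          have h := block_erase_subset hi₀ hij₀ hij (mem_block.2 (by simp)) hsf
          obtain ⟨rfl, rfl⟩ : i = i₀ ∧ j = j₀ := by omega
          rfl
      subset := hsV
      card := fun s hs => hs.1
      zero := fun s hs v hv => (hH s hs v (hsV s hs hv)).1 hv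
      pos := fun s hs v hv hvs => (hH s hs v hv).2 hvs
      pivot := fun s hs v hv => exists_boundaryFacets_exchange
        (Set.Finite.subset (Finset.range (N + 2)).powerset.finite_toSet fun f hf =>
          Finset.mem_coe.2 (Finset.mem_powerset.2 (hsubset f hf))) hcard
        (fun s hs f hf g hg h hh => ridge_in_at_most_two s hs (hIF hf) (hIF hg) (hIF hh)) hs hv }
  refine ⟨_, S.isSimplicialPolytope, ?_⟩
  rw [squeezedSphere, squeezedBall, boundaryComplex_spannedComplex (by norm_num) hcard]
  exact S.isRealizedAsBoundary
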